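/- Let $n\ge 1$, $r\ge 4$, $s\ge 1$, let $U\subset\mathbb{R}^n$ be open and connected, and let $x:U\to\mathbb{R}^{n+1}$ be an injective $C^r$-immersion with a unit normal field $\xi$, second fundamental form $h_{ij}=\langle \xi,x_{/ij}\rangle$ and nowhere vanishing Gaussian curvature $K$ (subscripts $/i$ denote partial derivatives). A relative $C^s$-normalization is a $C^s$-map $y:U\to\mathbb{R}^{n+1}$ which is nowhere tangent to the hypersurface and all of whose partial derivatives $y_{/i}$ are tangent to it. For such $y$ let $X$ be the covector with $\langle X,x_{/i}\rangle=0$, $\langle X,y\rangle=1$; let $G_{ij}=\langle X,x_{/ij}\rangle$ be the relative metric, with Levi-Civita connection $\nabla^G$ and second Beltrami operator $\triangle^G f=G^{ij}\nabla^G_j f_{/i}$ (applied componentwise to vector-valued functions); let $A_{ijk}=\langle X,\nabla^G_k\nabla^G_j x_{/i}\rangle$ be the Darboux tensor, $T=\frac1n A_{ijk}G^{jk}G^{im}x_{/m}$ the Tchebychev vector field, and $H=\frac1n B_i^i$ the relative mean curvature, where $y_{/i}=-B_i^j x_{/j}$. Let $q_{AFF}=|K|^{1/(n+2)}$, let $y_{AFF}=-h^{ij}(q_{AFF})_{/i}\,x_{/j}+q_{AFF}\,\xi$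 be the equiaffine normalization, and let $H_{AFF}$ be its relative mean curvature. Let $y_1,y_2$ be two relative $C^s$-normalizations of $x$ with relative metrics $G_1,G_2$, Tchebychev vector fields $T_1,T_2$ and relative mean curvatures $H_1,H_2$. If $T_2=\alpha T_1$ on $U$ for a constant $\alpha\in\mathbb{R}$, then there is a constant $\mu\in\mathbb{R}$ such that on $U$ $$\triangle^{G_2}x=\alpha\,\triangle^{G_1}x+n\mu\,y_{AFF}\qquad\text{and}\qquad H_2=\alpha H_1+\mu H_{AFF}.$$ -/

import Mathlib

namespace RelGeom

noncomputable section

/-- The Euclidean space `ℝ^m`. -/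
abbrev E (m : ℕ) : Type := EuclideanSpace ℝ (Fin m)

/-- The partial derivative `f_{/i} = ∂f/∂uⁱ`. -/
def partialD {n : ℕ} {V : Type*} [NormedAddCommGroup V] [NormedSpace ℝ V]
    (i : Fin n) (f : E n → V) (u : E n) : V :=
  fderiv ℝ f u (EuclideanSpace.single i 1)

/-- The tangent vector space of the hypersurface `x` at the parameter point `u`. -/
def tangentSpan {n : ℕ} (x : E n → E (n + 1)) (u : E n) : Submodule ℝ (E (n + 1)) :=
  Submodule.span ℝ (Set.range fun i : Fin n => partialD i x u)

/-- `x` is an injective `C^r`-immersion of the open set `U ⊆ ℝⁿ` into `ℝ^{n+1}`. -/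
structure IsHypersurface {n : ℕ} (r : WithTop ℕ∞) (U : Set (E n)) (x : E n → E (n + 1)) :
    Prop where
  isOpen : IsOpen U
  contDiffOn : ContDiffOn ℝ r x U
  injOn : Set.InjOn x U
  immersion : ∀ u ∈ U, LinearIndependent ℝ fun i : Fin n => partialD i x u

/-- `y` is a relative `C^s`-normalization of `x`: it is nowhere tangent, and all of its
partial derivatives are tangent. -/
structure IsRelativeNormalization {n : ℕ} (s : WithTop ℕ∞) (U : Set (E n))
    (x y : E n → E (n + 1)) : Prop where
  contDiffOn : ContDiffOn ℝ s y U
  transversal : ∀ u ∈ U, y u ∉ tangentSpan x u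
  tangential : ∀ u ∈ U, ∀ i, partialD i y u ∈ tangentSpan x u

/-- `ξ` is a Euclidean normalization (a unit normal field) of `x`. -/
structure IsEuclideanNormalization {n : ℕ} (U : Set (E n)) (x ξ : E n → E (n + 1)) :
    Prop where
  isRelativeNormalization : IsRelativeNormalization 1 U x ξ
  normal : ∀ u ∈ U, ∀ i, inner ℝ (ξ u) (partialD i x u) = 0
  unit : ∀ u ∈ U, ‖ξ u‖ = 1

/-! ### Euclidean quantities -/

/-- The first fundamental form `g_{ij} = ⟨x_{/i}, x_{/j}⟩`. -/
def firstForm {n : ℕ} (x : E n → E (n + 1)) (u : E n) : Matrix (Fin n) (Fin n) ℝ :=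
  Matrix.of fun i j => inner ℝ (partialD i x u) (partialD j x u)

/-- The second fundamental form `h_{ij} = ⟨ξ, x_{/ij}⟩`. -/
def secondForm {n : ℕ} (x ξ : E n → E (n + 1)) (u : E n) : Matrix (Fin n) (Fin n) ℝ :=
  Matrix.of fun i j => inner ℝ (ξ u) (partialD j (partialD i x) u)

/-- The Gaussian curvature `K = det h / det g`. -/
def gaussCurvature {n : ℕ} (x ξ : E n → E (n + 1)) (u : E n) : ℝ :=
  (secondForm x ξ u).det / (firstForm x u).det

/-! ### Tensor calculus of a (possibly indefinite) metric `G` on a domain of `ℝⁿ` -/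

/-- The Christoffel symbols
`Γ^k_{ij} = (1/2) G^{kl} (∂_i G_{jl} + ∂_j G_{il} - ∂_l G_{ij})` of the Levi-Civita connection. -/
def christoffel {n : ℕ} (G : E n → Matrix (Fin n) (Fin n) ℝ) (k i j : Fin n) (u : E n) : ℝ :=
  (1 / 2) * ∑ l, (G u)⁻¹ k l *
    (partialD i (fun v => G v j l) u + partialD j (fun v => G v i l) u
      - partialD l (fun v => G v i j) u)

/-- The covariant derivative `∇_j ω_i` of a vector-valued covariant 1-tensor `ω`. -/
def covD₁ {n : ℕ} {V : Type*} [NormedAddCommGroup V] [NormedSpace ℝ V]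
    (G : E n → Matrix (Fin n) (Fin n) ℝ) (ω : Fin n → E n → V) (i j : Fin n) (u : E n) : V :=
  partialD j (ω i) u - ∑ l, christoffel G l j i u • ω l u

/-- The covariant derivative `∇_k τ_{ij}` of a vector-valued covariant 2-tensor `τ`. -/
def covD₂ {n : ℕ} {V : Type*} [NormedAddCommGroup V] [NormedSpace ℝ V]
    (G : E n → Matrix (Fin n) (Fin n) ℝ) (τ : Fin n → Fin n → E n → V)
    (i j k : Fin n) (u : E n) : V :=
  partialD k (τ i j) u - ∑ l, christoffel G l k i u • τ l j u
    - ∑ l, christoffel G l k j u • τ i l u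

/-- The second Beltrami differential operator `Δ^G f = G^{ij} ∇_j f_{/i}`. -/
def beltrami {n : ℕ} {V : Type*} [NormedAddCommGroup V] [NormedSpace ℝ V]
    (G : E n → Matrix (Fin n) (Fin n) ℝ) (f : E n → V) (u : E n) : V :=
  ∑ i, ∑ j, (G u)⁻¹ i j • covD₁ G (fun m => partialD m f) i j u

/-! ### Quantities of a relative normalization `y` -/

/-- The covector `X` of the tangent hyperplane: the vector with `⟨X, x_{/i}⟩ = 0` for all `i`
and `⟨X, y⟩ = 1`. -/
def covector {n : ℕ} (x y : E n → E (n + 1)) (u : E n) : E (n + 1) :=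
  Classical.epsilon fun X : E (n + 1) =>
    (∀ i, inner ℝ X (partialD i x u) = 0) ∧ inner ℝ X (y u) = 1

/-- The relative metric `G_{ij} = ⟨X, x_{/ij}⟩`. -/
def relMetric {n : ℕ} (x y : E n → E (n + 1)) (u : E n) : Matrix (Fin n) (Fin n) ℝ :=
  Matrix.of fun i j => inner ℝ (covector x y u) (partialD j (partialD i x) u)

/-- The Darboux tensor `A_{ijk} = ⟨X, ∇^G_k ∇^G_j x_{/i}⟩`. -/
def darboux {n : ℕ} (x y : E n → E (n + 1)) (i j k : Fin n) (u : E n) : ℝ :=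
  inner ℝ (covector x y u)
    (covD₂ (relMetric x y) (covD₁ (relMetric x y) fun m => partialD m x) i j k u)

/-- The Tchebychev vector field `T = (1/n) A_{ijk} G^{jk} G^{im} x_{/m}`. -/
def tchebychev {n : ℕ} (x y : E n → E (n + 1)) (u : E n) : E (n + 1) :=
  (1 / (n : ℝ)) • ∑ i, ∑ j, ∑ k, ∑ m,
    (darboux x y i j k u * (relMetric x y u)⁻¹ j k * (relMetric x y u)⁻¹ i m) • partialD m x u

/-- The relative shape operator: the matrix `B i j = B_i^j` with `y_{/i} = -B_i^j x_{/j}`. -/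
def shapeOp {n : ℕ} (x y : E n → E (n + 1)) (u : E n) : Matrix (Fin n) (Fin n) ℝ :=
  Classical.epsilon fun B : Matrix (Fin n) (Fin n) ℝ =>
    ∀ i, partialD i y u = -∑ j, B i j • partialD j x u

/-- The relative mean curvature `H = (1/n) B_i^i`. -/
def relMeanCurvature {n : ℕ} (x y : E n → E (n + 1)) (u : E n) : ℝ :=
  (1 / (n : ℝ)) * (shapeOp x y u).trace

/-- The relative normalization `y = -h^{ij} q_{/i} x_{/j} + q ξ` with support function `q`. -/
def normalizationOfSupport {n : ℕ} (x ξ : E n → E (n + 1)) (q : E n → ℝ) (u : E n) :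
    E (n + 1) :=
  -(∑ i, ∑ j, ((secondForm x ξ u)⁻¹ i j * partialD i q u) • partialD j x u) + q u • ξ u

/-- The equiaffine support function `q_AFF = |K|^{1/(n+2)}`. -/
def qAff {n : ℕ} (x ξ : E n → E (n + 1)) (u : E n) : ℝ :=
  |gaussCurvature x ξ u| ^ (1 / ((n : ℝ) + 2))

/-- The equiaffine normalization. -/
def yAff {n : ℕ} (x ξ : E n → E (n + 1)) : E n → E (n + 1) :=
  normalizationOfSupport x ξ (qAff x ξ)

/-! ### The covector and the shape operator are characterised by their defining equations -/

theorem covector_eq_iff {n : ℕ} {r s : WithTop ℕ∞} {U : Set (E n)} {x y : E n → E (n + 1)}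
    (hx : IsHypersurface r U x) (hy : IsRelativeNormalization s U x y) {u : E n} (hu : u ∈ U)
    (X : E (n + 1)) :
    covector x y u = X ↔ (∀ i, inner ℝ X (partialD i x u) = 0) ∧ inner ℝ X (y u) = 1 := by
  set v : Fin (n + 1) → E (n + 1) := Fin.snoc (fun i : Fin n => partialD i x u) (y u) with hv
  have hli : LinearIndependent ℝ v :=
    linearIndependent_finSnoc.2 ⟨hx.immersion u hu, hy.transversal u hu⟩
  let b : Module.Basis (Fin (n + 1)) ℝ (E (n + 1)) :=
    basisOfLinearIndependentOfCardEqFinrank hli (by simp)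
  have hb : ∀ i, b i = v i := fun i => by simp [b]
  let P : E (n + 1) → Prop := fun X =>
    (∀ i, inner ℝ X (partialD i x u) = 0) ∧ inner ℝ X (y u) = 1
  have huniq : ∀ X Y, P X → P Y → X = Y := by
    intro X Y h1 h2
    refine InnerProductSpace.ext_inner_right_basis b fun i => ?_
    rw [hb]
    refine Fin.lastCases ?_ (fun j => ?_) i
    · simp [hv, h1.2, h2.2]
    · simp [hv, h1.1 j, h2.1 j]
  have hex : ∃ X, P X := by
    let l : E (n + 1) →L[ℝ] ℝ :=
      LinearMap.toContinuousLinearMap (b.constr ℝ (Pi.single (Fin.last n) (1 : ℝ)))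
    have hl : ∀ i, l (v i) = (Pi.single (Fin.last n) (1 : ℝ) : Fin (n + 1) → ℝ) i := fun i => by
      rw [← hb]
      simp only [l, LinearMap.coe_toContinuousLinearMap', Module.Basis.constr_basis]
    refine ⟨(InnerProductSpace.toDual ℝ (E (n + 1))).symm l, fun i => ?_, ?_⟩
    · rw [InnerProductSpace.toDual_symm_apply]
      have := hl i.castSucc
      simpa [hv] using this
    · rw [InnerProductSpace.toDual_symm_apply]
      have := hl (Fin.last n)
      simpa [hv] using this
  have hspec : P (covector x y u) := Classical.epsilon_spec hex
  exact ⟨fun h => h ▸ hspec, fun h => huniq _ _ hspec h⟩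

theorem shapeOp_eq_iff {n : ℕ} {r s : WithTop ℕ∞} {U : Set (E n)} {x y : E n → E (n + 1)}
    (hx : IsHypersurface r U x) (hy : IsRelativeNormalization s U x y) {u : E n} (hu : u ∈ U)
    (B : Matrix (Fin n) (Fin n) ℝ) :
    shapeOp x y u = B ↔ ∀ i, partialD i y u = -∑ j, B i j • partialD j x u := by
  have hex : ∃ B : Matrix (Fin n) (Fin n) ℝ,
      ∀ i, partialD i y u = -∑ j, B i j • partialD j x u := by
    have h : ∀ i, ∃ c : Fin n → ℝ, ∑ j, c j • partialD j x u = partialD i y u := fun i =>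
      (Submodule.mem_span_range_iff_exists_fun ℝ).1 (hy.tangential u hu i)
    choose c hc using h
    exact ⟨Matrix.of fun i j => -c i j, fun i => by simp [← hc i]⟩
  have hspec : ∀ i, partialD i y u = -∑ j, shapeOp x y u i j • partialD j x u :=
    Classical.epsilon_spec hex
  refine ⟨fun h => h ▸ hspec, fun h => ?_⟩
  ext i j
  have h1 : ∑ j, (shapeOp x y u i j - B i j) • partialD j x u = 0 := by
    have := (hspec i).symm.trans (h i)
    simp only [sub_smul, Finset.sum_sub_distrib]
    rw [sub_eq_zero]
    exact neg_injective this
  exact sub_eq_zero.1 (Fintype.linearIndependent_iff.1 (hx.immersion u hu) _ h1 j)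

end

end RelGeom

open RelGeom

namespace RelGeom

noncomputable section

/-! ### Partial derivatives -/

section Calculus

variable {n : ℕ} {V : Type*} [NormedAddCommGroup V] [NormedSpace ℝ V] {U : Set (E n)} {u : E n}

/-! A relative normalization is encoded by its support function `q = ⟨ξ, y⟩`. Since each `y_{/k}` is
tangent, `⟨ξ_{/k}, y⟩ = q_{/k}`, and as `K ≠ 0` the vectors `ξ, ξ_{/1}, …, ξ_{/n}` span, so `q` and
its gradient determine `y` linearly (`partialD_support`, `eq_zero_of_inner_euclidean`).

The Tchebychev field is also linear in `q`: `X = q⁻¹ ξ` gives `G = q⁻¹ h`, and tracing the Darboux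
tensor yields `2n ⟨ξ_{/p}, T⟩ = q (log |K|)_{/p} - (n + 2) q_{/p}` (`sum_darboux`,
`inner_partialD_euclidean_tchebychev`). Hence `T₂ = α T₁` says that `φ = q₂ - α q₁` satisfies `(n +
2) φ_{/p} = φ (log |K|)_{/p}`. The positive function `q_AFF = |K|^{1/(n+2)}` satisfies the same
equation, so `φ / q_AFF` is a constant `μ` on the connected set `U`. Therefore `y₂ = α y₁ + μ
y_AFF`.

The first claim now follows from `Δ^G x = n (T + y)` (`beltrami_eq`), which rests on the total
symmetry of the Darboux tensor. The second follows by differentiating the relation between the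
normalizations and taking traces of the shape operators. -/

theorem partialD_congr (hU : IsOpen U) (hu : u ∈ U) {f g : E n → V} (h : Set.EqOn f g U)
    (i : Fin n) : partialD i f u = partialD i g u := by
  unfold partialD
  rw [(h.eventuallyEq_of_mem (hU.mem_nhds hu)).fderiv_eq]

theorem partialD_const (i : Fin n) (c : V) : partialD i (fun _ => c) u = 0 := by
  simp [partialD]

theorem partialD_inner {W : Type*} [NormedAddCommGroup W] [InnerProductSpace ℝ W] {f g : E n → W}
    (hf : DifferentiableAt ℝ f u) (hg : DifferentiableAt ℝ g u) (i : Fin n) :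
    partialD i (fun v => (inner ℝ (f v) (g v) : ℝ)) u
      = inner ℝ (partialD i f u) (g u) + inner ℝ (f u) (partialD i g u) := by
  unfold partialD
  rw [fderiv_inner_apply ℝ hf hg, add_comm]

theorem partialD_sub {f g : E n → V}
    (hf : DifferentiableAt ℝ f u) (hg : DifferentiableAt ℝ g u) (i : Fin n) :
    partialD i (fun v => f v - g v) u = partialD i f u - partialD i g u := by
  unfold partialD
  rw [fderiv_fun_sub hf hg]; rfl

theorem partialD_const_smul {f : E n → V} (hf : DifferentiableAt ℝ f u) (c : ℝ) (i : Fin n) :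
    partialD i (fun v => c • f v) u = c • partialD i f u := by
  unfold partialD
  rw [fderiv_fun_const_smul hf]; rfl

theorem partialD_mul {f g : E n → ℝ}
    (hf : DifferentiableAt ℝ f u) (hg : DifferentiableAt ℝ g u) (i : Fin n) :
    partialD i (fun v => f v * g v) u = partialD i f u * g u + f u * partialD i g u := by
  unfold partialD
  rw [fderiv_fun_mul hf hg]
  simp; ring

theorem differentiableAt_div {f g : E n → ℝ} (hf : DifferentiableAt ℝ f u)
    (hg : DifferentiableAt ℝ g u) (h : g u ≠ 0) : DifferentiableAt ℝ (fun v => f v / g v) u := by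
  simp only [div_eq_mul_inv]
  exact hf.fun_mul (hg.fun_inv h)

theorem partialD_smul {f : E n → ℝ} {g : E n → V}
    (hf : DifferentiableAt ℝ f u) (hg : DifferentiableAt ℝ g u) (i : Fin n) :
    partialD i (fun v => f v • g v) u = partialD i f u • g u + f u • partialD i g u := by
  unfold partialD
  rw [fderiv_fun_smul hf hg]
  simp [add_comm]

theorem contDiffOn_partialD (hU : IsOpen U) {m k : WithTop ℕ∞} {f : E n → V}
    (hf : ContDiffOn ℝ k f U) (hmk : m + 1 ≤ k) (i : Fin n) :
    ContDiffOn ℝ m (partialD i f) U :=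
  (hf.fderiv_of_isOpen hU hmk).clm_apply contDiffOn_const

theorem partialD_comm (hU : IsOpen U) {f : E n → V} (hf : ContDiffOn ℝ 2 f U) (hu : u ∈ U)
    (i j : Fin n) : partialD j (partialD i f) u = partialD i (partialD j f) u := by
  have hd : DifferentiableAt ℝ (fderiv ℝ f) u :=
    ((hf.fderiv_of_isOpen hU (m := 1) (by norm_num)).contDiffAt (hU.mem_nhds hu)).differentiableAt
      (by simp)
  have key : ∀ i j : Fin n, partialD j (partialD i f) u
      = fderiv ℝ (fderiv ℝ f) u (EuclideanSpace.single j 1) (EuclideanSpace.single i 1) := by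
    intro i j
    have h1 : partialD i f = fun v => fderiv ℝ f v (EuclideanSpace.single i 1) := rfl
    rw [h1, partialD, fderiv_clm_apply hd (differentiableAt_const _)]
    simp
  rw [key, key]
  exact ((hf.contDiffAt (hU.mem_nhds hu)).isSymmSndFDerivAt (by simp)).eq _ _

theorem differentiableAt_of_contDiffOn (hU : IsOpen U) {m : WithTop ℕ∞} {f : E n → V}
    (hf : ContDiffOn ℝ m f U) (hm : 1 ≤ m) (hu : u ∈ U) : DifferentiableAt ℝ f u :=
  (hf.contDiffAt (hU.mem_nhds hu)).differentiableAt (by rintro rfl; simp at hm)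

theorem eq_const_of_partialD_eq_zero (hU : IsOpen U) (hc : IsPreconnected U) {f : E n → ℝ}
    (hf : DifferentiableOn ℝ f U) (h : ∀ u ∈ U, ∀ i, partialD i f u = 0) :
    ∃ c, ∀ u ∈ U, f u = c := by
  refine hU.exists_is_const_of_fderiv_eq_zero hc hf fun u hu => ?_
  ext v
  have : v = ∑ i, v i • EuclideanSpace.single i (1 : ℝ) := by
    ext j; simp [Pi.single_apply]
  rw [this, map_sum]
  exact Finset.sum_eq_zero fun i _ => by
    rw [map_smul]
    have := h u hu i
    unfold partialD at this
    simp [this]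

/-! ### Smoothness of determinants, inverses and solutions of linear systems -/

variable {m : Type*} [Fintype m] [DecidableEq m] {k : WithTop ℕ∞}

theorem contDiffOn_det {M : E n → Matrix m m ℝ} (hM : ∀ a b, ContDiffOn ℝ k (fun v => M v a b) U) :
    ContDiffOn ℝ k (fun v => (M v).det) U := by
  simp only [Matrix.det_apply]
  exact ContDiffOn.sum fun σ _ => (contDiffOn_prod fun a _ => hM _ _).const_smul _

theorem contDiffOn_inv {M : E n → Matrix m m ℝ} (hM : ∀ a b, ContDiffOn ℝ k (fun v => M v a b) U)
    (h0 : ∀ v ∈ U, (M v).det ≠ 0) (a b : m) : ContDiffOn ℝ k (fun v => (M v)⁻¹ a b) U := by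
  simp only [Matrix.inv_def, Matrix.smul_apply, Ring.inverse_eq_inv', smul_eq_mul,
    Matrix.adjugate_apply]
  refine ((contDiffOn_det hM).inv h0).mul (contDiffOn_det fun c d => ?_)
  by_cases h : c = b
  · subst h; simpa using contDiffOn_const
  · simpa [Matrix.updateRow_ne h] using hM c d

/-- With the frame vectors as rows of `M`, the products are the entries of `M Z`. Thus `Z` is
recovered through `M⁻¹`, whose entries are as smooth as the frame. -/
theorem contDiffOn_of_inner {N : ℕ} {w : Fin N → E n → E N} {Z : E n → E N}
    (hw : ∀ a, ContDiffOn ℝ k (w a) U) (hli : ∀ v ∈ U, LinearIndependent ℝ fun a => w a v)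
    (hZ : ∀ a, ContDiffOn ℝ k (fun v => (inner ℝ (Z v) (w a v) : ℝ)) U) : ContDiffOn ℝ k Z U := by
  let M : E n → Matrix (Fin N) (Fin N) ℝ := fun v => Matrix.of fun a b => w a v b
  have hM : ∀ a b, ContDiffOn ℝ k (fun v => M v a b) U := fun a b => contDiffOn_euclidean.1 (hw a) b
  have hM0 : ∀ v ∈ U, IsUnit (M v) := fun v hv => by
    rw [← Matrix.linearIndependent_rows_iff_isUnit]
    exact (hli v hv).map' (WithLp.linearEquiv 2 ℝ (Fin N → ℝ)).toLinearMap (LinearEquiv.ker _)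
  rw [contDiffOn_euclidean]
  intro b
  have : ContDiffOn ℝ k (fun v => ∑ a, (M v)⁻¹ b a * (inner ℝ (Z v) (w a v) : ℝ)) U :=
    ContDiffOn.sum fun a _ => (contDiffOn_inv hM (fun v hv =>
      ((Matrix.isUnit_iff_isUnit_det _).1 (hM0 v hv)).ne_zero) b a).mul (hZ a)
  refine this.congr fun v hv => ?_
  have h1 : (fun a => (inner ℝ (Z v) (w a v) : ℝ)) = (M v).mulVec (Z v) := by
    ext a; simp [M, PiLp.inner_apply, Matrix.mulVec, dotProduct]
  calc Z v b = ((M v)⁻¹.mulVec ((M v).mulVec (Z v))) b := by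
        rw [Matrix.mulVec_mulVec, Matrix.nonsing_inv_mul _ ((Matrix.isUnit_iff_isUnit_det _).1 (hM0 v hv)),
          Matrix.one_mulVec]
    _ = _ := by rw [← h1]; rfl

theorem differentiableAt_det {M : E n → Matrix m m ℝ}
    (hM : ∀ a b, DifferentiableAt ℝ (fun v => M v a b) u) :
    DifferentiableAt ℝ (fun v => (M v).det) u := by
  simp only [Matrix.det_apply]
  exact DifferentiableAt.fun_sum fun σ _ =>
    DifferentiableAt.const_smul (HasFDerivAt.finsetProd fun a _ => (hM _ _).hasFDerivAt).differentiableAt _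

/-- Jacobi's formula for the derivative of a determinant. -/
theorem partialD_det {M : E n → Matrix m m ℝ}
    (hM : ∀ a b, DifferentiableAt ℝ (fun v => M v a b) u) (h0 : (M u).det ≠ 0) (i : Fin n) :
    partialD i (fun v => (M v).det) u
      = (M u).det * ∑ a, ∑ b, (M u)⁻¹ a b * partialD i (fun v => M v b a) u := by
  -- As a function of its rows the determinant is multilinear, so its derivative is a sum of
  -- determinants with one row differentiated. Cramer's rule turns these into adjugate entries.
  let D : ContinuousMultilinearMap ℝ (fun _ : m => m → ℝ) ℝ :=
    { (Matrix.detRowAlternating (n := m) (R := ℝ)).toMultilinearMap with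
      cont := Continuous.matrix_det (A := fun M : Matrix m m ℝ => M) continuous_id }
  have hD : ∀ A : Matrix m m ℝ, D A = A.det := fun A => rfl
  have hM' : HasFDerivAt (fun v => (M v : m → m → ℝ))
      (ContinuousLinearMap.pi fun a => ContinuousLinearMap.pi fun b =>
        fderiv ℝ (fun v => M v a b) u) u :=
    hasFDerivAt_pi.2 fun a => hasFDerivAt_pi.2 fun b => (hM a b).hasFDerivAt
  have h := (D.hasFDerivAt (M u)).comp u hM'
  have h2 : fderiv ℝ (fun v => (M v).det) u = _ := h.fderiv
  rw [partialD, h2]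
  have h3 : ∀ a b, (M u)⁻¹ a b = (M u).det⁻¹ * (M u).adjugate a b := fun a b => by
    simp [Matrix.inv_def]
  refine (D.linearDeriv_apply _ _).trans ?_
  rw [Finset.sum_comm, Finset.mul_sum]
  refine Finset.sum_congr rfl fun a _ => ?_
  change D (Matrix.updateRow (M u) a fun b => partialD i (fun v => M v a b) u) = _
  rw [hD, ← Matrix.cramer_transpose_apply, Matrix.cramer_eq_adjugate_mulVec,
    ← Matrix.adjugate_transpose, Finset.mul_sum]
  simp only [Matrix.mulVec, dotProduct, Matrix.transpose_apply, h3]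
  refine Finset.sum_congr rfl fun b _ => ?_
  field_simp

end Calculus

/-! ### The covector field and the relative metric of a relative normalization -/

section Normalization

variable {n : ℕ} {r s : WithTop ℕ∞} {U : Set (E n)} {x y : E n → E (n + 1)} {u : E n}

theorem inner_covector_partialD (hx : IsHypersurface r U x) (hy : IsRelativeNormalization s U x y)
    (hu : u ∈ U) (i : Fin n) : inner ℝ (covector x y u) (partialD i x u) = 0 :=
  ((covector_eq_iff hx hy hu _).1 rfl).1 i

theorem inner_covector_normalization (hx : IsHypersurface r U x)
    (hy : IsRelativeNormalization s U x y) (hu : u ∈ U) : inner ℝ (covector x y u) (y u) = 1 :=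
  ((covector_eq_iff hx hy hu _).1 rfl).2

theorem inner_eq_zero_of_mem_tangentSpan {X v : E (n + 1)}
    (hX : ∀ i, inner ℝ X (partialD i x u) = 0) (hv : v ∈ tangentSpan x u) : inner ℝ X v = 0 := by
  refine Submodule.span_induction ?_ (by simp) (fun a b _ _ ha hb => ?_) (fun c a _ ha => ?_) hv
  · rintro _ ⟨i, rfl⟩; exact hX i
  · rw [inner_add_right, ha, hb, add_zero]
  · rw [inner_smul_right, ha, mul_zero]

theorem linearIndependent_frame (hx : IsHypersurface r U x) (hy : IsRelativeNormalization s U x y)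
    (hu : u ∈ U) : LinearIndependent ℝ
      (Fin.snoc (fun i : Fin n => partialD i x u) (y u) : Fin (n + 1) → E (n + 1)) :=
  linearIndependent_finSnoc.2 ⟨hx.immersion u hu, hy.transversal u hu⟩

theorem exists_frame_decomposition (hx : IsHypersurface r U x)
    (hy : IsRelativeNormalization s U x y) (hu : u ∈ U) (V : E (n + 1)) :
    ∃ (a : Fin n → ℝ) (b : ℝ), V = ∑ i, a i • partialD i x u + b • y u := by
  have hli := linearIndependent_frame hx hy hu
  have htop := hli.span_eq_top_of_card_eq_finrank' (by simp)
  obtain ⟨c, hc⟩ := (Submodule.mem_span_range_iff_exists_fun ℝ).1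
    (htop ▸ Submodule.mem_top : V ∈ _)
  exact ⟨fun i => c i.castSucc, c (Fin.last n), by simp [← hc, Fin.sum_univ_castSucc]⟩

theorem contDiffOn_partialD_partialD (hx : IsHypersurface r U x) {m : WithTop ℕ∞}
    (hr : m + 1 + 1 ≤ r) (i j : Fin n) : ContDiffOn ℝ m (partialD j (partialD i x)) U :=
  contDiffOn_partialD hx.isOpen (contDiffOn_partialD hx.isOpen hx.contDiffOn hr i) le_rfl j

theorem contDiffOn_of_inner_frame (hr : 2 ≤ r) (hs : 1 ≤ s) (hx : IsHypersurface r U x)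
    (hy : IsRelativeNormalization s U x y) {Z : E n → E (n + 1)}
    (h1 : ∀ i, ContDiffOn ℝ 1 (fun v => (inner ℝ (Z v) (partialD i x v) : ℝ)) U)
    (h2 : ContDiffOn ℝ 1 (fun v => (inner ℝ (Z v) (y v) : ℝ)) U) : ContDiffOn ℝ 1 Z U := by
  refine contDiffOn_of_inner
    (w := fun a v => (Fin.snoc (fun i : Fin n => partialD i x v) (y v) : Fin (n + 1) → E (n + 1)) a)
    (fun a => ?_) (fun v hv => linearIndependent_frame hx hy hv) (fun a => ?_)
  · refine Fin.lastCases ?_ (fun i => ?_) a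
    · simpa using hy.contDiffOn.of_le hs
    · simpa using contDiffOn_partialD hx.isOpen hx.contDiffOn
        (le_trans (by norm_num) hr) i
  · refine Fin.lastCases ?_ (fun i => ?_) a
    · simpa using h2
    · simpa using h1 i

theorem contDiffOn_covector (hr : 2 ≤ r) (hs : 1 ≤ s) (hx : IsHypersurface r U x)
    (hy : IsRelativeNormalization s U x y) : ContDiffOn ℝ 1 (covector x y) U :=
  contDiffOn_of_inner_frame hr hs hx hy
    (fun i => (contDiffOn_const (c := (0 : ℝ))).congr fun _ hv => inner_covector_partialD hx hy hv i)
    ((contDiffOn_const (c := (1 : ℝ))).congr fun _ hv => inner_covector_normalization hx hy hv)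

theorem relMetric_symm (hr : 2 ≤ r) (hx : IsHypersurface r U x) (hu : u ∈ U) (i j : Fin n) :
    relMetric x y u i j = relMetric x y u j i := by
  simp only [relMetric, Matrix.of_apply]
  rw [partialD_comm hx.isOpen (hx.contDiffOn.of_le hr) hu]

theorem inner_partialD_covector_partialD (hr : 2 ≤ r) (hs : 1 ≤ s) (hx : IsHypersurface r U x)
    (hy : IsRelativeNormalization s U x y) (hu : u ∈ U) (k i : Fin n) :
    inner ℝ (partialD k (covector x y) u) (partialD i x u) = -relMetric x y u i k := by
  have h := partialD_congr hx.isOpen hu (f := fun v => (inner ℝ (covector x y v) (partialD i x v) : ℝ))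
    (g := fun _ => 0) (fun v hv => inner_covector_partialD hx hy hv i) k
  rw [partialD_const, partialD_inner
    (differentiableAt_of_contDiffOn hx.isOpen (contDiffOn_covector hr hs hx hy) le_rfl hu)
    (differentiableAt_of_contDiffOn hx.isOpen (contDiffOn_partialD hx.isOpen hx.contDiffOn
      (m := 1) (le_trans (by norm_num) hr) i) le_rfl hu)] at h
  simp only [relMetric, Matrix.of_apply]
  linarith

theorem inner_partialD_covector_normalization (hr : 2 ≤ r) (hs : 1 ≤ s) (hx : IsHypersurface r U x)
    (hy : IsRelativeNormalization s U x y) (hu : u ∈ U) (k : Fin n) :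
    inner ℝ (partialD k (covector x y) u) (y u) = 0 := by
  have h := partialD_congr hx.isOpen hu (f := fun v => (inner ℝ (covector x y v) (y v) : ℝ))
    (g := fun _ => 1) (fun v hv => inner_covector_normalization hx hy hv) k
  rw [partialD_const, partialD_inner
    (differentiableAt_of_contDiffOn hx.isOpen (contDiffOn_covector hr hs hx hy) le_rfl hu)
    (differentiableAt_of_contDiffOn hx.isOpen hy.contDiffOn hs hu),
    inner_eq_zero_of_mem_tangentSpan (fun i => inner_covector_partialD hx hy hu i)
      (hy.tangential u hu k)] at h
  linarith

theorem contDiffOn_relMetric (hr : 3 ≤ r) (hs : 1 ≤ s) (hx : IsHypersurface r U x)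
    (hy : IsRelativeNormalization s U x y) (i j : Fin n) :
    ContDiffOn ℝ 1 (fun v => relMetric x y v i j) U :=
  (contDiffOn_covector (le_trans (by norm_num) hr) hs hx hy).inner ℝ
    (contDiffOn_partialD_partialD hx (le_trans (by norm_num) hr) i j)

/-- A derivative is gained here: `y` may be merely `C¹`, yet the products of `X_{/k}` with the frame
are `-G_{ik}` and `0`, which are again `C¹`. -/
theorem contDiffOn_partialD_covector (hr : 3 ≤ r) (hs : 1 ≤ s) (hx : IsHypersurface r U x)
    (hy : IsRelativeNormalization s U x y) (k : Fin n) :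
    ContDiffOn ℝ 1 (partialD k (covector x y)) U := by
  have hr2 : 2 ≤ r := le_trans (by norm_num) hr
  exact contDiffOn_of_inner_frame hr2 hs hx hy
    (fun i => (contDiffOn_relMetric hr hs hx hy i k).neg.congr fun v hv =>
      inner_partialD_covector_partialD hr2 hs hx hy hv k i)
    ((contDiffOn_const (c := (0 : ℝ))).congr fun v hv =>
      inner_partialD_covector_normalization hr2 hs hx hy hv k)

theorem partialD_relMetric (hr : 3 ≤ r) (hs : 1 ≤ s) (hx : IsHypersurface r U x)
    (hy : IsRelativeNormalization s U x y) (hu : u ∈ U) (i j k : Fin n) :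
    partialD k (fun v => relMetric x y v i j) u
      = inner ℝ (partialD k (covector x y) u) (partialD j (partialD i x) u)
        + inner ℝ (covector x y u) (partialD k (partialD j (partialD i x)) u) :=
  partialD_inner
    (differentiableAt_of_contDiffOn hx.isOpen
      (contDiffOn_covector (le_trans (by norm_num) hr) hs hx hy) le_rfl hu)
    (differentiableAt_of_contDiffOn hx.isOpen
      (contDiffOn_partialD_partialD hx (m := 1) (le_trans (by norm_num) hr) i j) le_rfl hu) k

/-- The product rule leaves only `X`, `X_{/k}` and derivatives of `x` up to order three. Requiring
the latter to be `C¹` is what calls for `4 ≤ r`. -/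
theorem contDiffOn_partialD_relMetric (hr : 4 ≤ r) (hs : 1 ≤ s) (hx : IsHypersurface r U x)
    (hy : IsRelativeNormalization s U x y) (i j k : Fin n) :
    ContDiffOn ℝ 1 (partialD k fun v => relMetric x y v i j) U := by
  have hr3 : 3 ≤ r := le_trans (by norm_num) hr
  have hr2 : 2 ≤ r := le_trans (by norm_num) hr
  refine ContDiffOn.congr ?_ fun v hv => partialD_relMetric hr3 hs hx hy hv i j k
  have h2 : ContDiffOn ℝ 2 (partialD j (partialD i x)) U :=
    contDiffOn_partialD_partialD hx (le_trans (by norm_num) hr) i j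
  exact ((contDiffOn_partialD_covector hr3 hs hx hy k).inner ℝ (h2.of_le (by norm_num))).add
    ((contDiffOn_covector hr2 hs hx hy).inner ℝ
      (contDiffOn_partialD hx.isOpen h2 (by norm_num) k))

theorem contDiffOn_christoffel (hr : 4 ≤ r) (hs : 1 ≤ s) (hx : IsHypersurface r U x)
    (hy : IsRelativeNormalization s U x y) (hG : ∀ v ∈ U, (relMetric x y v).det ≠ 0)
    (k i j : Fin n) : ContDiffOn ℝ 1 (christoffel (relMetric x y) k i j) U := by
  refine contDiffOn_const.mul (ContDiffOn.sum fun l _ => ?_)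
  exact (contDiffOn_inv (contDiffOn_relMetric (le_trans (by norm_num) hr) hs hx hy) hG k l).mul
    (((contDiffOn_partialD_relMetric hr hs hx hy _ _ _).add
      (contDiffOn_partialD_relMetric hr hs hx hy _ _ _)).sub
      (contDiffOn_partialD_relMetric hr hs hx hy _ _ _))

theorem contDiffOn_hessian (hr : 4 ≤ r) (hs : 1 ≤ s) (hx : IsHypersurface r U x)
    (hy : IsRelativeNormalization s U x y) (hG : ∀ v ∈ U, (relMetric x y v).det ≠ 0)
    (i j : Fin n) : ContDiffOn ℝ 1 (covD₁ (relMetric x y) (fun m => partialD m x) i j) U := by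
  refine (contDiffOn_partialD_partialD hx (le_trans (by norm_num) hr) i j).sub
    (ContDiffOn.sum fun l _ => ?_)
  exact (contDiffOn_christoffel hr hs hx hy hG l j i).smul
    (contDiffOn_partialD hx.isOpen hx.contDiffOn (le_trans (by norm_num) hr) l)

/-! ### The Darboux tensor and its symmetries -/

theorem inner_covector_hessian (hx : IsHypersurface r U x)
    (hy : IsRelativeNormalization s U x y) (hu : u ∈ U) (i j : Fin n) :
    inner ℝ (covector x y u) (covD₁ (relMetric x y) (fun m => partialD m x) i j u)
      = relMetric x y u i j := by
  simp only [covD₁, inner_sub_right, inner_sum, inner_smul_right,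
    inner_covector_partialD hx hy hu, mul_zero, Finset.sum_const_zero, sub_zero]
  rfl

theorem sum_inv_mul {M : Matrix (Fin n) (Fin n) ℝ} (h : M.det ≠ 0) (i j : Fin n) :
    ∑ l, M⁻¹ i l * M l j = if i = j then 1 else 0 := by
  rw [← Matrix.mul_apply, Matrix.nonsing_inv_mul _ (Ne.isUnit h), Matrix.one_apply]

theorem sum_mul_inv {M : Matrix (Fin n) (Fin n) ℝ} (h : M.det ≠ 0) (i j : Fin n) :
    ∑ l, M i l * M⁻¹ l j = if i = j then 1 else 0 := by
  rw [← Matrix.mul_apply, Matrix.mul_nonsing_inv _ (Ne.isUnit h), Matrix.one_apply]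

theorem inv_symm {M : Matrix (Fin n) (Fin n) ℝ} (h : ∀ i j, M i j = M j i) (i j : Fin n) :
    M⁻¹ i j = M⁻¹ j i := by
  have h1 : M.transpose = M := by ext a b; exact h b a
  conv_lhs => rw [← h1, ← Matrix.transpose_nonsing_inv]
  rfl

/-- The Christoffel symbols of the first kind. -/
theorem sum_christoffel_mul {G : E n → Matrix (Fin n) (Fin n) ℝ} (hG : (G u).det ≠ 0)
    (hsymm : ∀ i j, G u i j = G u j i) (i j k : Fin n) :
    ∑ l, christoffel G l i j u * G u l k
      = (1 / 2) * (partialD i (fun v => G v j k) u + partialD j (fun v => G v i k) u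
      - partialD k (fun v => G v i j) u) := by
  have h : ∀ l, christoffel G l i j u * G u l k = (1 / 2) * ∑ m, (G u k l * (G u)⁻¹ l m) *
      (partialD i (fun v => G v j m) u + partialD j (fun v => G v i m) u
      - partialD m (fun v => G v i j) u) := fun l => by
    rw [christoffel, hsymm l k, mul_assoc, Finset.sum_mul]
    congr 1
    exact Finset.sum_congr rfl fun m _ => by ring
  simp only [h]
  rw [← Finset.mul_sum, Finset.sum_comm]
  simp only [← Finset.sum_mul, sum_mul_inv hG]
  simp

theorem darboux_eq (hr : 4 ≤ r) (hs : 1 ≤ s) (hx : IsHypersurface r U x)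
    (hy : IsRelativeNormalization s U x y) (hG : ∀ v ∈ U, (relMetric x y v).det ≠ 0)
    (hu : u ∈ U) (i j k : Fin n) :
    darboux x y i j k u = -inner ℝ (partialD k (covector x y) u)
      (covD₁ (relMetric x y) (fun m => partialD m x) i j u) := by
  have hr2 : 2 ≤ r := le_trans (by norm_num) hr
  have hsymm : ∀ v ∈ U, ∀ i j, relMetric x y v i j = relMetric x y v j i :=
    fun v hv => relMetric_symm hr2 hx hv
  have h := partialD_congr hx.isOpen hu (f := fun v => (inner ℝ (covector x y v)
      (covD₁ (relMetric x y) (fun m => partialD m x) i j v) : ℝ))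
    (g := fun v => relMetric x y v i j) (fun v hv => inner_covector_hessian hx hy hv i j) k
  rw [partialD_inner
    (differentiableAt_of_contDiffOn hx.isOpen (contDiffOn_covector hr2 hs hx hy) le_rfl hu)
    (differentiableAt_of_contDiffOn hx.isOpen (contDiffOn_hessian hr hs hx hy hG i j) le_rfl hu)]
    at h
  -- Differentiating `⟨X, ∇_j x_{/i}⟩ = G_{ij}` gives the claim up to `∇_k G_{ij}`, which vanishes:
  -- the two Christoffel sums below add up to `∂_k G_{ij}`.
  have e1 := sum_christoffel_mul (hG u hu) (hsymm u hu) k i j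
  have e2 := sum_christoffel_mul (hG u hu) (hsymm u hu) k j i
  have hs' : ∀ a b c, partialD c (fun v => relMetric x y v a b) u
      = partialD c (fun v => relMetric x y v b a) u := fun a b c =>
    partialD_congr hx.isOpen hu (fun v hv => hsymm v hv a b) c
  rw [darboux, covD₂]
  simp only [inner_sub_right, inner_sum, inner_smul_right, inner_covector_hessian hx hy hu]
  simp only [hsymm u hu i]
  rw [e1, e2]
  rw [hs' j i] at *
  rw [hs' k i, hs' k j] at *
  linarith

theorem inner_partialD_covector_hessian (hr : 3 ≤ r) (hs : 1 ≤ s) (hx : IsHypersurface r U x)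
    (hy : IsRelativeNormalization s U x y)
    (hu : u ∈ U) (i j k : Fin n) :
    inner ℝ (partialD k (covector x y) u) (covD₁ (relMetric x y) (fun m => partialD m x) i j u)
      = inner ℝ (partialD k (covector x y) u) (partialD j (partialD i x) u)
        + ∑ l, christoffel (relMetric x y) l j i u * relMetric x y u l k := by
  rw [covD₁]
  simp only [inner_sub_right, inner_sum, inner_smul_right,
    inner_partialD_covector_partialD (le_trans (by norm_num) hr) hs hx hy hu]
  simp

/-- Expanding the Christoffel symbols of the first kind by the product rule removes all reference to
the connection. The result is visibly symmetric in `i, j, k`, because partial derivatives of `x`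
commute. -/
theorem darboux_eq_symmetrized (hr : 4 ≤ r) (hs : 1 ≤ s) (hx : IsHypersurface r U x)
    (hy : IsRelativeNormalization s U x y) (hG : ∀ v ∈ U, (relMetric x y v).det ≠ 0)
    (hu : u ∈ U) (i j k : Fin n) :
    darboux x y i j k u = -(1 / 2) * (
      inner ℝ (partialD i (covector x y) u) (partialD k (partialD j x) u)
      + inner ℝ (partialD j (covector x y) u) (partialD k (partialD i x) u)
      + inner ℝ (partialD k (covector x y) u) (partialD j (partialD i x) u)
      + inner ℝ (covector x y u) (partialD k (partialD j (partialD i x)) u)) := by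
  have hr3 : 3 ≤ r := le_trans (by norm_num) hr
  have hr2 : 2 ≤ r := le_trans (by norm_num) hr
  have hx1 : ∀ a, ContDiffOn ℝ 2 (partialD a x) U := fun a =>
    contDiffOn_partialD hx.isOpen hx.contDiffOn (le_trans (by norm_num) hr) a
  have c1 : ∀ a b c, partialD c (partialD b (partialD a x)) u
      = partialD c (partialD a (partialD b x)) u := fun a b c =>
    partialD_congr hx.isOpen hu
      (fun v hv => partialD_comm hx.isOpen (hx.contDiffOn.of_le hr2) hv a b) c
  have c2 : ∀ a b c, partialD c (partialD b (partialD a x)) u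
      = partialD b (partialD c (partialD a x)) u := fun a b c =>
    partialD_comm hx.isOpen (hx1 a) hu b c
  rw [darboux_eq hr hs hx hy hG hu, inner_partialD_covector_hessian hr3 hs hx hy hu,
    sum_christoffel_mul (hG u hu) (relMetric_symm hr2 hx hu),
    partialD_relMetric hr3 hs hx hy hu, partialD_relMetric hr3 hs hx hy hu,
    partialD_relMetric hr3 hs hx hy hu, partialD_comm hx.isOpen (hx.contDiffOn.of_le hr2) hu j i,
    c1 j i k, c2 i k j, c2 j k i, c1 j i k]
  ring

theorem darboux_swap_left (hr : 4 ≤ r) (hs : 1 ≤ s) (hx : IsHypersurface r U x)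
    (hy : IsRelativeNormalization s U x y) (hG : ∀ v ∈ U, (relMetric x y v).det ≠ 0)
    (hu : u ∈ U) (i j k : Fin n) : darboux x y i j k u = darboux x y j i k u := by
  have hr2 : 2 ≤ r := le_trans (by norm_num) hr
  have c1 : partialD k (partialD j (partialD i x)) u = partialD k (partialD i (partialD j x)) u :=
    partialD_congr hx.isOpen hu
      (fun v hv => partialD_comm hx.isOpen (hx.contDiffOn.of_le hr2) hv i j) k
  rw [darboux_eq_symmetrized hr hs hx hy hG hu, darboux_eq_symmetrized hr hs hx hy hG hu, c1,
    partialD_comm hx.isOpen (hx.contDiffOn.of_le hr2) hu i j]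
  ring

theorem darboux_swap_right (hr : 4 ≤ r) (hs : 1 ≤ s) (hx : IsHypersurface r U x)
    (hy : IsRelativeNormalization s U x y) (hG : ∀ v ∈ U, (relMetric x y v).det ≠ 0)
    (hu : u ∈ U) (i j k : Fin n) : darboux x y i j k u = darboux x y i k j u := by
  have hr2 : 2 ≤ r := le_trans (by norm_num) hr
  have hx1 : ContDiffOn ℝ 2 (partialD i x) U :=
    contDiffOn_partialD hx.isOpen hx.contDiffOn (le_trans (by norm_num) hr) i
  rw [darboux_eq_symmetrized hr hs hx hy hG hu, darboux_eq_symmetrized hr hs hx hy hG hu,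
    partialD_comm hx.isOpen hx1 hu j k,
    partialD_comm hx.isOpen (hx.contDiffOn.of_le hr2) hu j k]
  ring

/-- Vectors are detected by the covector and its partial derivatives. -/
theorem eq_zero_of_inner_covector (hr : 2 ≤ r) (hs : 1 ≤ s) (hx : IsHypersurface r U x)
    (hy : IsRelativeNormalization s U x y) (hu : u ∈ U) (hG : (relMetric x y u).det ≠ 0)
    {V : E (n + 1)} (h0 : inner ℝ (covector x y u) V = 0)
    (h1 : ∀ k, inner ℝ (partialD k (covector x y) u) V = 0) : V = 0 := by
  obtain ⟨a, b, rfl⟩ := exists_frame_decomposition hx hy hu V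
  -- The pairing of `X_{/k}, X` with the frame `x_{/i}, y` is block diagonal with blocks `-G` and
  -- `1`, hence nondegenerate.
  simp only [inner_add_right, inner_sum, inner_smul_right, inner_covector_partialD hx hy hu,
    inner_covector_normalization hx hy hu, inner_partialD_covector_normalization hr hs hx hy hu,
    inner_partialD_covector_partialD hr hs hx hy hu] at h0 h1
  have hb : b = 0 := by simpa using h0
  have ha : Matrix.vecMul a (relMetric x y u) = 0 := by
    ext k
    have := h1 k
    simp only [mul_neg, Finset.sum_neg_distrib, mul_zero, add_zero, neg_eq_zero] at this
    exact this
  rw [Matrix.eq_zero_of_vecMul_eq_zero hG ha, hb]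
  simp

/-! ### The Tchebychev vector field and the Beltrami operator -/

theorem inner_covector_tchebychev (hx : IsHypersurface r U x)
    (hy : IsRelativeNormalization s U x y) (hu : u ∈ U) :
    inner ℝ (covector x y u) (tchebychev x y u) = 0 := by
  simp [tchebychev, inner_smul_right, inner_sum, inner_covector_partialD hx hy hu]

theorem inner_partialD_covector_tchebychev (hn : 1 ≤ n) (hr : 2 ≤ r) (hs : 1 ≤ s)
    (hx : IsHypersurface r U x) (hy : IsRelativeNormalization s U x y) (hu : u ∈ U)
    (hG : (relMetric x y u).det ≠ 0) (p : Fin n) :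
    (n : ℝ) * inner ℝ (partialD p (covector x y) u) (tchebychev x y u)
      = -∑ j, ∑ k, darboux x y p j k u * (relMetric x y u)⁻¹ j k := by
  have hn0 : (n : ℝ) ≠ 0 := by positivity
  simp only [tchebychev, inner_smul_right, inner_sum,
    inner_partialD_covector_partialD hr hs hx hy hu, mul_neg, Finset.sum_neg_distrib, mul_assoc,
    ← Finset.mul_sum, sum_inv_mul hG]
  rw [← mul_assoc, mul_one_div_cancel hn0, one_mul]
  congr 1
  rw [Finset.sum_eq_single p]
  · simp
  · intro b _ hb; simp [hb]
  · simp

/-- Both sides are tested against `X` and all `X_{/p}`. Against `X` each gives `n`. Against `X_{/p}`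
each gives `-G^{ij} A_{pij}`, where total symmetry of `A` is used and `y` drops out. -/
theorem beltrami_eq (hn : 1 ≤ n) (hr : 4 ≤ r) (hs : 1 ≤ s) (hx : IsHypersurface r U x)
    (hy : IsRelativeNormalization s U x y) (hG : ∀ v ∈ U, (relMetric x y v).det ≠ 0)
    (hu : u ∈ U) :
    beltrami (relMetric x y) x u = (n : ℝ) • (tchebychev x y u + y u) := by
  have hr2 : 2 ≤ r := le_trans (by norm_num) hr
  rw [← sub_eq_zero]
  refine eq_zero_of_inner_covector hr2 hs hx hy hu (hG u hu) ?_ fun p => ?_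
  · rw [inner_sub_right, inner_smul_right, inner_add_right, inner_covector_tchebychev hx hy hu,
      inner_covector_normalization hx hy hu, beltrami]
    simp only [inner_sum, inner_smul_right, inner_covector_hessian hx hy hu]
    have : ∀ i, ∑ j, (relMetric x y u)⁻¹ i j * relMetric x y u i j = 1 := fun i => by
      simpa [fun j => relMetric_symm (y := y) hr2 hx hu j i] using sum_inv_mul (hG u hu) i i
    simp [this]
  · rw [inner_sub_right, inner_smul_right, inner_add_right,
      inner_partialD_covector_normalization hr2 hs hx hy hu, add_zero,
      inner_partialD_covector_tchebychev hn hr2 hs hx hy hu (hG u hu), beltrami]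
    have h : ∀ i j, inner ℝ (partialD p (covector x y) u)
        (covD₁ (relMetric x y) (fun m => partialD m x) i j u) = -darboux x y p i j u := fun i j => by
      rw [darboux_swap_left hr hs hx hy hG hu, darboux_swap_right hr hs hx hy hG hu,
        darboux_eq hr hs hx hy hG hu, neg_neg]
    simp only [inner_sum, inner_smul_right, h]
    simp [mul_comm]

end Normalization

/-! ### The support function of a relative normalization -/

section Support

variable {n : ℕ} {r s : WithTop ℕ∞} {U : Set (E n)} {x ξ y : E n → E (n + 1)} {u : E n}

/-- The support function `q = ⟨ξ, y⟩` of a relative normalization. -/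
def support {n : ℕ} (ξ y : E n → E (n + 1)) (u : E n) : ℝ := inner ℝ (ξ u) (y u)

/-- The trace `tr (M⁻¹ ∂ᵢ M)`, the logarithmic derivative of `det M`. -/
def logDetD {n : ℕ} (M : E n → Matrix (Fin n) (Fin n) ℝ) (i : Fin n) (u : E n) : ℝ :=
  ∑ a, ∑ b, (M u)⁻¹ a b * partialD i (fun v => M v b a) u

/-- The Euclidean theory is the special case `y = ξ`, with `X = ξ` and `G = h`, so the general
lemmas apply to `ξ`. -/
theorem covector_euclidean (hx : IsHypersurface r U x) (hξ : IsEuclideanNormalization U x ξ)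
    (hu : u ∈ U) : covector x ξ u = ξ u :=
  (covector_eq_iff hx hξ.isRelativeNormalization hu _).2
    ⟨hξ.normal u hu, by rw [real_inner_self_eq_norm_sq, hξ.unit u hu]; norm_num⟩

theorem relMetric_euclidean (hx : IsHypersurface r U x) (hξ : IsEuclideanNormalization U x ξ)
    (hu : u ∈ U) : relMetric x ξ u = secondForm x ξ u := by
  ext i j
  simp only [relMetric, secondForm, Matrix.of_apply, covector_euclidean hx hξ hu]

theorem partialD_covector_euclidean (hx : IsHypersurface r U x)
    (hξ : IsEuclideanNormalization U x ξ) (hu : u ∈ U) (k : Fin n) :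
    partialD k (covector x ξ) u = partialD k ξ u :=
  partialD_congr hx.isOpen hu (fun _ hv => covector_euclidean hx hξ hv) k

theorem inner_partialD_euclidean_partialD (hr : 2 ≤ r) (hx : IsHypersurface r U x)
    (hξ : IsEuclideanNormalization U x ξ) (hu : u ∈ U) (k i : Fin n) :
    inner ℝ (partialD k ξ u) (partialD i x u) = -secondForm x ξ u i k := by
  rw [← partialD_covector_euclidean hx hξ hu, ← relMetric_euclidean hx hξ hu]
  exact inner_partialD_covector_partialD hr le_rfl hx hξ.isRelativeNormalization hu k i

theorem inner_partialD_euclidean_self (hr : 2 ≤ r) (hx : IsHypersurface r U x)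
    (hξ : IsEuclideanNormalization U x ξ) (hu : u ∈ U) (k : Fin n) :
    inner ℝ (partialD k ξ u) (ξ u) = 0 := by
  rw [← partialD_covector_euclidean hx hξ hu]
  exact inner_partialD_covector_normalization hr le_rfl hx hξ.isRelativeNormalization hu k

theorem det_secondForm_ne_zero (hK : gaussCurvature x ξ u ≠ 0) : (secondForm x ξ u).det ≠ 0 :=
  fun h => hK (by simp [gaussCurvature, h])

theorem det_firstForm_ne_zero (hK : gaussCurvature x ξ u ≠ 0) : (firstForm x u).det ≠ 0 :=
  fun h => hK (by simp [gaussCurvature, h])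

theorem firstForm_symm (i j : Fin n) : firstForm x u i j = firstForm x u j i := by
  simp only [firstForm, Matrix.of_apply]
  exact real_inner_comm _ _

theorem secondForm_symm (hr : 2 ≤ r) (hx : IsHypersurface r U x) (hu : u ∈ U) (i j : Fin n) :
    secondForm x ξ u i j = secondForm x ξ u j i := by
  simp only [secondForm, Matrix.of_apply]
  rw [partialD_comm hx.isOpen (hx.contDiffOn.of_le hr) hu]

/-- Vectors are detected by the unit normal field and its partial derivatives. -/
theorem eq_zero_of_inner_euclidean (hr : 2 ≤ r) (hx : IsHypersurface r U x)
    (hξ : IsEuclideanNormalization U x ξ) (hu : u ∈ U) (hK : gaussCurvature x ξ u ≠ 0)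
    {V : E (n + 1)} (h0 : inner ℝ (ξ u) V = 0)
    (h1 : ∀ k, inner ℝ (partialD k ξ u) V = 0) : V = 0 :=
  eq_zero_of_inner_covector hr le_rfl hx hξ.isRelativeNormalization hu
    (by rw [relMetric_euclidean hx hξ hu]; exact det_secondForm_ne_zero hK)
    (by rwa [covector_euclidean hx hξ hu])
    (fun k => by rw [partialD_covector_euclidean hx hξ hu]; exact h1 k)

theorem support_ne_zero (hx : IsHypersurface r U x) (hξ : IsEuclideanNormalization U x ξ)
    (hy : IsRelativeNormalization s U x y) (hu : u ∈ U) : support ξ y u ≠ 0 := by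
  obtain ⟨a, b, h⟩ := exists_frame_decomposition hx hξ.isRelativeNormalization hu (y u)
  have hb : support ξ y u = b := by
    rw [support, h]
    simp [inner_add_right, inner_sum, inner_smul_right, hξ.normal u hu, hξ.unit u hu]
  rw [hb]
  rintro rfl
  refine hy.transversal u hu ?_
  rw [h, zero_smul, add_zero]
  exact Submodule.sum_mem _ fun i _ => Submodule.smul_mem _ _ (Submodule.subset_span ⟨i, rfl⟩)

/-- The tangent hyperplane has a single normal line, and `⟨X, y⟩ = 1` fixes the factor. Consequently
all relative metrics of `x` are conformal to `h`. -/
theorem covector_eq_smul (hx : IsHypersurface r U x) (hξ : IsEuclideanNormalization U x ξ)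
    (hy : IsRelativeNormalization s U x y) (hu : u ∈ U) :
    covector x y u = (support ξ y u)⁻¹ • ξ u := by
  refine (covector_eq_iff hx hy hu _).2 ⟨fun i => ?_, ?_⟩
  · rw [inner_smul_left, hξ.normal u hu, mul_zero]
  · rw [inner_smul_left]
    exact inv_mul_cancel₀ (support_ne_zero hx hξ hy hu)

theorem relMetric_eq_smul (hx : IsHypersurface r U x) (hξ : IsEuclideanNormalization U x ξ)
    (hy : IsRelativeNormalization s U x y) (hu : u ∈ U) :
    relMetric x y u = (support ξ y u)⁻¹ • secondForm x ξ u := by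
  ext i j
  simp [relMetric, secondForm, covector_eq_smul hx hξ hy hu, inner_smul_left]

theorem relMetric_inv_eq_smul (hx : IsHypersurface r U x) (hξ : IsEuclideanNormalization U x ξ)
    (hy : IsRelativeNormalization s U x y) (hu : u ∈ U) (hK : gaussCurvature x ξ u ≠ 0) :
    (relMetric x y u)⁻¹ = support ξ y u • (secondForm x ξ u)⁻¹ := by
  have hq := support_ne_zero hx hξ hy hu
  refine Matrix.inv_eq_right_inv ?_
  rw [relMetric_eq_smul hx hξ hy hu, Matrix.smul_mul, Matrix.mul_smul, smul_smul,
    inv_mul_cancel₀ hq, one_smul,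
    Matrix.mul_nonsing_inv _ (Ne.isUnit (det_secondForm_ne_zero hK))]

theorem det_relMetric_ne_zero (hx : IsHypersurface r U x) (hξ : IsEuclideanNormalization U x ξ)
    (hy : IsRelativeNormalization s U x y) (hu : u ∈ U) (hK : gaussCurvature x ξ u ≠ 0) :
    (relMetric x y u).det ≠ 0 := by
  rw [relMetric_eq_smul hx hξ hy hu, Matrix.det_smul]
  exact mul_ne_zero (pow_ne_zero _ (inv_ne_zero (support_ne_zero hx hξ hy hu)))
    (det_secondForm_ne_zero hK)

theorem differentiableAt_support (hs : 1 ≤ s) (hx : IsHypersurface r U x)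
    (hξ : IsEuclideanNormalization U x ξ) (hy : IsRelativeNormalization s U x y) (hu : u ∈ U) :
    DifferentiableAt ℝ (support ξ y) u :=
  (differentiableAt_of_contDiffOn hx.isOpen hξ.isRelativeNormalization.contDiffOn le_rfl hu).inner ℝ
    (differentiableAt_of_contDiffOn hx.isOpen hy.contDiffOn hs hu)

/-- The term `⟨ξ, y_{/k}⟩` vanishes by tangency, so the gradient of `q` supplies the products of `y`
with the `ξ_{/k}`. -/
theorem partialD_support (hs : 1 ≤ s) (hx : IsHypersurface r U x)
    (hξ : IsEuclideanNormalization U x ξ) (hy : IsRelativeNormalization s U x y) (hu : u ∈ U)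
    (k : Fin n) : partialD k (support ξ y) u = inner ℝ (partialD k ξ u) (y u) := by
  refine (partialD_inner
    (differentiableAt_of_contDiffOn hx.isOpen hξ.isRelativeNormalization.contDiffOn le_rfl hu)
    (differentiableAt_of_contDiffOn hx.isOpen hy.contDiffOn hs hu) k).trans ?_
  rw [inner_eq_zero_of_mem_tangentSpan (hξ.normal u hu) (hy.tangential u hu k), add_zero]

theorem differentiableAt_secondForm (hr : 3 ≤ r) (hx : IsHypersurface r U x)
    (hξ : IsEuclideanNormalization U x ξ) (hu : u ∈ U) (i j : Fin n) :
    DifferentiableAt ℝ (fun v => secondForm x ξ v i j) u :=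
  (differentiableAt_of_contDiffOn hx.isOpen hξ.isRelativeNormalization.contDiffOn le_rfl hu).inner ℝ
    (differentiableAt_of_contDiffOn hx.isOpen
      (contDiffOn_partialD_partialD hx (m := 1) (le_trans (by norm_num) hr) i j) le_rfl hu)

theorem differentiableAt_partialD (hr : 2 ≤ r) (hx : IsHypersurface r U x) (hu : u ∈ U)
    (i : Fin n) : DifferentiableAt ℝ (partialD i x) u :=
  differentiableAt_of_contDiffOn hx.isOpen
    (contDiffOn_partialD hx.isOpen hx.contDiffOn (m := 1) (le_trans (by norm_num) hr) i) le_rfl hu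

theorem partialD_inv_support (hs : 1 ≤ s) (hx : IsHypersurface r U x)
    (hξ : IsEuclideanNormalization U x ξ) (hy : IsRelativeNormalization s U x y) (hu : u ∈ U)
    (k : Fin n) : partialD k (fun v => (support ξ y v)⁻¹) u
      = -((support ξ y u)⁻¹ * (support ξ y u)⁻¹ * partialD k (support ξ y) u) := by
  have hq := support_ne_zero hx hξ hy hu
  have h := ((hasFDerivAt_inv hq).comp u
    (differentiableAt_support hs hx hξ hy hu).hasFDerivAt).fderiv
  unfold partialD
  refine (congrArg (fun L => L (EuclideanSpace.single k 1)) h).trans ?_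
  simp
  ring

theorem partialD_relMetric_eq (hr : 3 ≤ r) (hs : 1 ≤ s) (hx : IsHypersurface r U x)
    (hξ : IsEuclideanNormalization U x ξ) (hy : IsRelativeNormalization s U x y) (hu : u ∈ U)
    (i j k : Fin n) : partialD k (fun v => relMetric x y v i j) u
      = (support ξ y u)⁻¹ * (partialD k (fun v => secondForm x ξ v i j) u
        - (support ξ y u)⁻¹ * partialD k (support ξ y) u * secondForm x ξ u i j) := by
  rw [partialD_congr hx.isOpen hu (g := fun v => (support ξ y v)⁻¹ * secondForm x ξ v i j)
    (fun v hv => by simp [relMetric_eq_smul hx hξ hy hv]),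
    partialD_mul ((differentiableAt_support hs hx hξ hy hu).fun_inv (support_ne_zero hx hξ hy hu))
      (differentiableAt_secondForm hr hx hξ hu i j), partialD_inv_support hs hx hξ hy hu]
  ring

theorem partialD_covector_eq (hs : 1 ≤ s) (hx : IsHypersurface r U x)
    (hξ : IsEuclideanNormalization U x ξ) (hy : IsRelativeNormalization s U x y) (hu : u ∈ U)
    (k : Fin n) : partialD k (covector x y) u
      = (support ξ y u)⁻¹ • (partialD k ξ u
        - ((support ξ y u)⁻¹ * partialD k (support ξ y) u) • ξ u) := by
  rw [partialD_congr hx.isOpen hu (fun v hv => covector_eq_smul hx hξ hy hv),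
    partialD_smul ((differentiableAt_support hs hx hξ hy hu).fun_inv (support_ne_zero hx hξ hy hu))
      (differentiableAt_of_contDiffOn hx.isOpen hξ.isRelativeNormalization.contDiffOn le_rfl hu),
    partialD_inv_support hs hx hξ hy hu]
  module

/-- The Weingarten equations. -/
theorem weingarten (hr : 2 ≤ r) (hx : IsHypersurface r U x) (hξ : IsEuclideanNormalization U x ξ)
    (hu : u ∈ U) (hK : gaussCurvature x ξ u ≠ 0) (j : Fin n) :
    ∑ k, (secondForm x ξ u)⁻¹ j k • partialD k ξ u
      = -∑ m, (firstForm x u)⁻¹ j m • partialD m x u := by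
  have hh := det_secondForm_ne_zero hK
  have hg := det_firstForm_ne_zero hK
  rw [← sub_eq_zero, sub_neg_eq_add]
  set V := ∑ k, (secondForm x ξ u)⁻¹ j k • partialD k ξ u
    + ∑ m, (firstForm x u)⁻¹ j m • partialD m x u with hV
  have h0 : inner ℝ V (ξ u) = 0 := by
    rw [hV]
    simp [inner_add_left, sum_inner, inner_smul_left, inner_partialD_euclidean_self hr hx hξ hu,
      real_inner_comm (ξ u) (partialD _ x u), hξ.normal u hu]
  have h1 : ∀ l, inner ℝ V (partialD l x u) = 0 := fun l => by
    have e : ∀ m, inner ℝ (partialD m x u) (partialD l x u) = firstForm x u m l := fun _ => rfl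
    rw [hV]
    simp only [inner_add_left, sum_inner, inner_smul_left,
      inner_partialD_euclidean_partialD hr hx hξ hu, e, secondForm_symm hr hx hu l]
    simp [sum_inv_mul hg, sum_inv_mul hh]
  obtain ⟨a, b, h⟩ := exists_frame_decomposition hx hξ.isRelativeNormalization hu V
  -- `V` is orthogonal to a basis, hence to itself.
  rw [← inner_self_eq_zero (𝕜 := ℝ)]
  nth_rw 2 [h]
  simp [inner_add_right, inner_sum, inner_smul_right, h0, h1]

/-! ### The trace of the Darboux tensor in terms of the support function -/

theorem partialD_firstForm (hr : 2 ≤ r) (hx : IsHypersurface r U x) (hu : u ∈ U) (a b i : Fin n) :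
    partialD i (fun v => firstForm x v a b) u
      = inner ℝ (partialD i (partialD a x) u) (partialD b x u)
        + inner ℝ (partialD a x u) (partialD i (partialD b x) u) :=
  partialD_inner (differentiableAt_partialD hr hx hu a) (differentiableAt_partialD hr hx hu b) i

/-- By the Weingarten equations the sum becomes `-g^{jm} ⟨x_{/m}, x_{/ij}⟩`, and twice this is
`-g^{jm} ∂_i g_{jm}`. -/
theorem sum_inv_secondForm_mul_inner (hr : 2 ≤ r) (hx : IsHypersurface r U x)
    (hξ : IsEuclideanNormalization U x ξ) (hu : u ∈ U) (hK : gaussCurvature x ξ u ≠ 0)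
    (i : Fin n) :
    2 * ∑ j, ∑ k, (secondForm x ξ u)⁻¹ j k *
        inner ℝ (partialD k ξ u) (partialD j (partialD i x) u) = -logDetD (firstForm x) i u := by
  have h1 : ∀ j, ∑ k, (secondForm x ξ u)⁻¹ j k *
        inner ℝ (partialD k ξ u) (partialD j (partialD i x) u)
      = -∑ m, (firstForm x u)⁻¹ j m * inner ℝ (partialD m x u) (partialD i (partialD j x) u) := by
    intro j
    have := congrArg (fun V => inner ℝ V (partialD j (partialD i x) u))
      (weingarten hr hx hξ hu hK j)
    simp only [sum_inner, inner_smul_left, inner_neg_left, conj_trivial] at this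
    rw [this, partialD_comm hx.isOpen (hx.contDiffOn.of_le hr) hu]
  have h2 : ∑ j, ∑ m, (firstForm x u)⁻¹ j m *
      inner ℝ (partialD j x u) (partialD i (partialD m x) u)
      = ∑ j, ∑ m, (firstForm x u)⁻¹ j m *
        inner ℝ (partialD m x u) (partialD i (partialD j x) u) := by
    rw [Finset.sum_comm]
    exact Finset.sum_congr rfl fun a _ => Finset.sum_congr rfl fun b _ => by
      rw [inv_symm firstForm_symm]
  have h3 : logDetD (firstForm x) i u = ∑ j, ∑ m, (firstForm x u)⁻¹ j m *
        inner ℝ (partialD m x u) (partialD i (partialD j x) u) + ∑ j, ∑ m, (firstForm x u)⁻¹ j m *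
      inner ℝ (partialD j x u) (partialD i (partialD m x) u) := by
    simp only [logDetD, partialD_firstForm hr hx hu, mul_add, Finset.sum_add_distrib]
    rw [add_comm]
    congr 1
    exact Finset.sum_congr rfl fun a _ => Finset.sum_congr rfl fun b _ => by
      rw [real_inner_comm]
  rw [h3, h2]
  simp only [h1, Finset.sum_neg_distrib]
  ring

theorem sum_inv_secondForm_mul_secondForm (hr : 2 ≤ r) (hx : IsHypersurface r U x) (hu : u ∈ U)
    (hK : gaussCurvature x ξ u ≠ 0) :
    ∑ j, ∑ k, (secondForm x ξ u)⁻¹ j k * secondForm x ξ u j k = n := by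
  have : ∀ j, ∑ k, (secondForm x ξ u)⁻¹ j k * secondForm x ξ u j k = 1 := fun j => by
    simpa [fun k => secondForm_symm (ξ := ξ) hr hx hu k j]
      using sum_inv_mul (det_secondForm_ne_zero hK) j j
  simp [this]

theorem sum_darboux (hr : 4 ≤ r) (hs : 1 ≤ s) (hx : IsHypersurface r U x)
    (hξ : IsEuclideanNormalization U x ξ) (hK : ∀ v ∈ U, gaussCurvature x ξ v ≠ 0)
    (hy : IsRelativeNormalization s U x y) (hu : u ∈ U) (i : Fin n) :
    2 * support ξ y u * ∑ j, ∑ k, darboux x y i j k u * (relMetric x y u)⁻¹ j k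
      = (n + 2) * partialD i (support ξ y) u
        + support ξ y u * (logDetD (firstForm x) i u - logDetD (secondForm x ξ) i u) := by
  have hr3 : 3 ≤ r := le_trans (by norm_num) hr
  have hr2 : 2 ≤ r := le_trans (by norm_num) hr
  have hG : ∀ v ∈ U, (relMetric x y v).det ≠ 0 :=
    fun v hv => det_relMetric_ne_zero hx hξ hy hv (hK v hv)
  have hq := support_ne_zero hx hξ hy hu
  set q := support ξ y u with hqd
  set H := (secondForm x ξ u)⁻¹ with hH
  have hsymm : ∀ a b c, partialD c (fun v => secondForm x ξ v a b) u
      = partialD c (fun v => secondForm x ξ v b a) u := fun a b c =>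
    partialD_congr hx.isOpen hu (fun v hv => secondForm_symm hr2 hx hv a b) c
  have hHs : ∀ a b, H a b = H b a := inv_symm (secondForm_symm hr2 hx hu)
  -- Substitution of `X = q⁻¹ ξ` and `G = q⁻¹ h`. The last two bracketed groups are exchanged by `j
  -- ↔ k` with opposite signs and cancel on summation.
  have hterm : ∀ j k, q * (darboux x y i j k u * (relMetric x y u)⁻¹ j k)
      = -q * (H j k * inner ℝ (partialD k ξ u) (partialD j (partialD i x) u))
        + partialD k (support ξ y) u * (H k j * secondForm x ξ u j i)
        - q / 2 * (H j k * partialD i (fun v => secondForm x ξ v k j) u)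
        + (1 / 2) * partialD i (support ξ y) u * (H j k * secondForm x ξ u j k)
        - (q / 2 * (H j k * (partialD j (fun v => secondForm x ξ v i k) u))
          - (1 / 2) * (H j k * (partialD j (support ξ y) u * secondForm x ξ u i k)))
        + (q / 2 * (H k j * (partialD k (fun v => secondForm x ξ v i j) u))
          - (1 / 2) * (H k j * (partialD k (support ξ y) u * secondForm x ξ u i j))) := by
    intro j k
    have e : (inner ℝ (ξ u) (partialD j (partialD i x) u) : ℝ) = secondForm x ξ u i j := rfl
    rw [darboux_eq hr hs hx hy hG hu, inner_partialD_covector_hessian hr3 hs hx hy hu,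
      sum_christoffel_mul (hG u hu) (relMetric_symm hr2 hx hu),
      partialD_covector_eq hs hx hξ hy hu, relMetric_inv_eq_smul hx hξ hy hu (hK u hu)]
    simp only [partialD_relMetric_eq hr3 hs hx hξ hy hu, inner_smul_left, inner_sub_left, e,
      Matrix.smul_apply, smul_eq_mul, conj_trivial]
    rw [← hqd, ← hH, hsymm k j, hsymm j i, hHs k j, secondForm_symm hr2 hx hu j i]
    field_simp
    ring
  have hcontr : ∑ j, ∑ k, partialD k (support ξ y) u * (H k j * secondForm x ξ u j i)
      = partialD i (support ξ y) u := by
    rw [Finset.sum_comm]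
    simp only [← Finset.mul_sum, hH, sum_inv_mul (det_secondForm_ne_zero (hK u hu))]
    simp
  have hswap : ∀ F : Fin n → Fin n → ℝ, ∑ j, ∑ k, F k j = ∑ j, ∑ k, F j k :=
    fun F => Finset.sum_comm
  have hg := sum_inv_secondForm_mul_inner hr2 hx hξ hu (hK u hu) i
  have hh := sum_inv_secondForm_mul_secondForm (ξ := ξ) hr2 hx hu (hK u hu)
  rw [← hH] at hg hh
  have hmain : q * ∑ j, ∑ k, darboux x y i j k u * (relMetric x y u)⁻¹ j k
      = -q * ∑ j, ∑ k, H j k * inner ℝ (partialD k ξ u) (partialD j (partialD i x) u)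
        + partialD i (support ξ y) u - q / 2 * logDetD (secondForm x ξ) i u
        + (1 / 2) * partialD i (support ξ y) u * n := by
    rw [← hh]
    simp only [Finset.mul_sum, hterm]
    simp only [Finset.sum_add_distrib, Finset.sum_sub_distrib]
    rw [hcontr,
      hswap (fun j k => q / 2 * (H j k * (partialD j (fun v => secondForm x ξ v i k) u))),
      hswap (fun j k => (1 / 2) * (H j k * (partialD j (support ξ y) u * secondForm x ξ u i k)))]
    simp only [logDetD, Finset.mul_sum, ← hH]
    ring
  linear_combination 2 * hmain - q * hg

/-! ### Gaussian curvature and the equiaffine normalization -/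

theorem partialD_gaussCurvature (hr : 3 ≤ r) (hx : IsHypersurface r U x)
    (hξ : IsEuclideanNormalization U x ξ)
    (hK : ∀ v ∈ U, gaussCurvature x ξ v ≠ 0) (hu : u ∈ U) :
    DifferentiableAt ℝ (gaussCurvature x ξ) u ∧ ∀ i, partialD i (gaussCurvature x ξ) u
      = gaussCurvature x ξ u * (logDetD (secondForm x ξ) i u - logDetD (firstForm x) i u) := by
  have hr2 : 2 ≤ r := le_trans (by norm_num) hr
  have hg := det_firstForm_ne_zero (hK u hu)
  have hh := det_secondForm_ne_zero (hK u hu)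
  have dg' : ∀ a b, DifferentiableAt ℝ (fun v => firstForm x v a b) u := fun a b =>
    (differentiableAt_partialD hr2 hx hu a).inner ℝ (differentiableAt_partialD hr2 hx hu b)
  have dh' := differentiableAt_secondForm hr hx hξ hu
  have dg := differentiableAt_det dg'
  have dh := differentiableAt_det dh'
  have dK : DifferentiableAt ℝ (gaussCurvature x ξ) u :=
    differentiableAt_div dh dg hg
  refine ⟨dK, fun i => ?_⟩
  -- Differentiating `K det g = det h` with Jacobi's formula avoids the quotient rule.
  have h := partialD_congr hx.isOpen hu (f := fun v => (secondForm x ξ v).det)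
    (g := fun v => gaussCurvature x ξ v * (firstForm x v).det)
    (fun v hv => (div_mul_cancel₀ _ (det_firstForm_ne_zero (hK v hv))).symm) i
  have hKg : gaussCurvature x ξ u * (firstForm x u).det = (secondForm x ξ u).det :=
    div_mul_cancel₀ _ hg
  rw [partialD_mul dK dg, partialD_det dh' hh, partialD_det dg' hg, ← hKg] at h
  refine mul_right_cancel₀ hg ?_
  simp only [logDetD]
  linear_combination -h

theorem qAff_pos (hK : gaussCurvature x ξ u ≠ 0) : 0 < qAff x ξ u :=
  Real.rpow_pos_of_pos (abs_pos.2 hK) _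

theorem partialD_qAff (hr : 3 ≤ r) (hx : IsHypersurface r U x)
    (hξ : IsEuclideanNormalization U x ξ) (hK : ∀ v ∈ U, gaussCurvature x ξ v ≠ 0) (hu : u ∈ U) :
    DifferentiableAt ℝ (qAff x ξ) u ∧ ∀ i, (n + 2) * partialD i (qAff x ξ) u
      = qAff x ξ u * (logDetD (secondForm x ξ) i u - logDetD (firstForm x) i u) := by
  -- `Real.log` ignores signs, so this form is differentiable whether `K` is positive or negative.
  have heq : Set.EqOn (qAff x ξ)
      (fun v => Real.exp (Real.log (gaussCurvature x ξ v) * (1 / ((n : ℝ) + 2)))) U :=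
    fun v hv => by
      rw [qAff, Real.rpow_def_of_pos (abs_pos.2 (hK v hv)), Real.log_abs]
  obtain ⟨dK, hKd⟩ := partialD_gaussCurvature hr hx hξ hK hu
  have hd := ((dK.hasFDerivAt.log (hK u hu)).mul_const (1 / ((n : ℝ) + 2))).exp
  refine ⟨hd.differentiableAt.congr_of_eventuallyEq
    (heq.eventuallyEq_of_mem (hx.isOpen.mem_nhds hu)), fun i => ?_⟩
  have hn : (n : ℝ) + 2 ≠ 0 := by positivity
  have hKi := hKd i
  rw [partialD_congr hx.isOpen hu heq, heq hu]
  unfold partialD at hKi ⊢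
  rw [hd.fderiv]
  have := hK u hu
  simp [hKi]
  field_simp

theorem inner_euclidean_tchebychev (hξ : IsEuclideanNormalization U x ξ) (hu : u ∈ U) :
    inner ℝ (ξ u) (tchebychev x y u) = 0 := by
  simp [tchebychev, inner_smul_right, inner_sum, hξ.normal u hu]

/-- The right side is linear in the support function and its gradient, with coefficients depending
on `x` and `ξ` alone. It vanishes exactly when `q` satisfies the equation of `q_AFF` in
`partialD_qAff`. -/
theorem inner_partialD_euclidean_tchebychev (hn : 1 ≤ n) (hr : 4 ≤ r) (hs : 1 ≤ s)
    (hx : IsHypersurface r U x) (hξ : IsEuclideanNormalization U x ξ)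
    (hK : ∀ v ∈ U, gaussCurvature x ξ v ≠ 0) (hy : IsRelativeNormalization s U x y) (hu : u ∈ U)
    (p : Fin n) :
    2 * n * inner ℝ (partialD p ξ u) (tchebychev x y u)
      = support ξ y u * (logDetD (secondForm x ξ) p u - logDetD (firstForm x) p u)
        - (n + 2) * partialD p (support ξ y) u := by
  have h := inner_partialD_covector_tchebychev hn (le_trans (by norm_num) hr) hs hx hy hu
    (det_relMetric_ne_zero hx hξ hy hu (hK u hu)) p
  rw [partialD_covector_eq hs hx hξ hy hu, inner_smul_left, inner_sub_left, inner_smul_left,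
    inner_euclidean_tchebychev hξ hu, mul_zero, sub_zero, conj_trivial] at h
  have h2 := sum_darboux hr hs hx hξ hK hy hu p
  have hq := support_ne_zero hx hξ hy hu
  have h3 : n * inner ℝ (partialD p ξ u) (tchebychev x y u)
      = -(support ξ y u * ∑ j, ∑ k, darboux x y p j k u * (relMetric x y u)⁻¹ j k) := by
    field_simp at h
    linear_combination h
  linear_combination 2 * h3 - h2

theorem inner_euclidean_yAff (hξ : IsEuclideanNormalization U x ξ)
    (hu : u ∈ U) : inner ℝ (ξ u) (yAff x ξ u) = qAff x ξ u := by
  simp [yAff, normalizationOfSupport, inner_add_right, inner_sum, inner_smul_right,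
    hξ.normal u hu, hξ.unit u hu]

/-- The analogue of `partialD_support`, read off from the explicit formula and so available before
`y_AFF` is known to be a relative normalization. -/
theorem inner_partialD_euclidean_yAff (hr : 2 ≤ r) (hx : IsHypersurface r U x)
    (hξ : IsEuclideanNormalization U x ξ) (hu : u ∈ U) (hK : gaussCurvature x ξ u ≠ 0)
    (k : Fin n) :
    inner ℝ (partialD k ξ u) (yAff x ξ u) = partialD k (qAff x ξ) u := by
  simp only [yAff, normalizationOfSupport, inner_add_right, inner_neg_right, inner_sum,
    inner_smul_right, inner_partialD_euclidean_partialD hr hx hξ hu,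
    inner_partialD_euclidean_self hr hx hξ hu, mul_neg, Finset.sum_neg_distrib,
    mul_zero, add_zero, mul_right_comm _ (partialD _ (qAff x ξ) u), ← Finset.sum_mul,
    sum_inv_mul (det_secondForm_ne_zero hK)]
  simp

end Support

end

end RelGeom

open RelGeom

/-! ### The main theorem -/

theorem mainTheorem10 {n : ℕ} (hn : 1 ≤ n) (r s : WithTop ℕ∞) (hr : 4 ≤ r) (hs : 1 ≤ s)
    (U : Set (E n)) (hU : IsPreconnected U)
    (x ξ y₁ y₂ : E n → E (n + 1))
    (hx : IsHypersurface r U x)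
    (hξ : IsEuclideanNormalization U x ξ)
    (hK : ∀ u ∈ U, gaussCurvature x ξ u ≠ 0)
    (hy₁ : IsRelativeNormalization s U x y₁)
    (hy₂ : IsRelativeNormalization s U x y₂)
    (α : ℝ) (hT : ∀ u ∈ U, tchebychev x y₂ u = α • tchebychev x y₁ u) :
    ∃ μ : ℝ, ∀ u ∈ U,
      beltrami (relMetric x y₂) x u
          = α • beltrami (relMetric x y₁) x u + ((n : ℝ) * μ) • yAff x ξ u ∧
      relMeanCurvature x y₂ u
          = α * relMeanCurvature x y₁ u + μ * relMeanCurvature x (yAff x ξ) u := by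
  have hr3 : 3 ≤ r := le_trans (by norm_num) hr
  have hr2 : 2 ≤ r := le_trans (by norm_num) hr
  set φ : E n → ℝ := fun v => support ξ y₂ v - α * support ξ y₁ v with hφ
  have dα : ∀ u ∈ U, DifferentiableAt ℝ (fun v => α * support ξ y₁ v) u := fun u hu =>
    (differentiableAt_support hs hx hξ hy₁ hu).const_mul α
  have dφ : ∀ u ∈ U, DifferentiableAt ℝ φ u := fun u hu =>
    (differentiableAt_support hs hx hξ hy₂ hu).sub (dα u hu)
  have hφ' : ∀ u ∈ U, ∀ i, partialD i φ u
      = partialD i (support ξ y₂) u - α * partialD i (support ξ y₁) u := fun u hu i => by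
    rw [hφ, partialD_sub (differentiableAt_support hs hx hξ hy₂ hu) (dα u hu)]
    congr 1
    exact partialD_const_smul (differentiableAt_support hs hx hξ hy₁ hu) α i
  have hode : ∀ u ∈ U, ∀ i, (n + 2) * partialD i φ u
      = φ u * (logDetD (secondForm x ξ) i u - logDetD (firstForm x) i u) := fun u hu i => by
    have h1 := inner_partialD_euclidean_tchebychev hn hr hs hx hξ hK hy₁ hu i
    have h2 := inner_partialD_euclidean_tchebychev hn hr hs hx hξ hK hy₂ hu i
    rw [hT u hu, inner_smul_right] at h2
    rw [hφ' u hu]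
    linear_combination h2 - α * h1
  have hn2 : (n : ℝ) + 2 ≠ 0 := by positivity
  obtain ⟨μ, hμ⟩ : ∃ μ, ∀ u ∈ U, φ u / qAff x ξ u = μ := by
    refine eq_const_of_partialD_eq_zero hx.isOpen hU (fun u hu => ?_) fun u hu i => ?_
    · exact (differentiableAt_div (dφ u hu) (partialD_qAff hr3 hx hξ hK hu).1
        (qAff_pos (hK u hu)).ne').differentiableWithinAt
    · obtain ⟨dQ, hQ⟩ := partialD_qAff hr3 hx hξ hK hu
      have hQ0 := (qAff_pos (hK u hu)).ne'
      have hd : DifferentiableAt ℝ (fun v => φ v / qAff x ξ v) u :=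
        differentiableAt_div (dφ u hu) dQ hQ0
      have h1 := partialD_congr hx.isOpen hu (f := φ)
        (g := fun v => φ v / qAff x ξ v * qAff x ξ v)
        -- The product rule for `φ = (φ / q_AFF) q_AFF`, combined with the common equation of `φ`
        -- and `q_AFF`, leaves `(φ / q_AFF)_{/i} (n + 2) q_AFF = 0`.
        (fun v hv => (div_mul_cancel₀ _ (qAff_pos (hK v hv)).ne').symm) i
      rw [partialD_mul hd dQ] at h1
      refine (mul_eq_zero.1 ?_).resolve_right (mul_ne_zero hn2 hQ0)
      have h2 := hode u hu i
      have h3 := hQ i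
      have h4 : φ u / qAff x ξ u * qAff x ξ u = φ u := div_mul_cancel₀ _ hQ0
      linear_combination (-(n + 2 : ℝ)) * h1 + h2 - φ u / qAff x ξ u * h3
        - (logDetD (secondForm x ξ) i u - logDetD (firstForm x) i u) * h4
  have hφμ : ∀ u ∈ U, φ u = μ * qAff x ξ u := fun u hu =>
    (div_eq_iff (qAff_pos (hK u hu)).ne').1 (hμ u hu)
  -- The two sides agree against `ξ` by the relation of support functions, and against `ξ_{/k}` by
  -- its derivative.
  have hy : ∀ u ∈ U, y₂ u = α • y₁ u + μ • yAff x ξ u := fun u hu => by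
    rw [← sub_eq_zero]
    refine eq_zero_of_inner_euclidean hr2 hx hξ hu (hK u hu) ?_ fun k => ?_
    · rw [inner_sub_right, inner_add_right, inner_smul_right, inner_smul_right,
        inner_euclidean_yAff hξ hu]
      have := hφμ u hu
      simp only [hφ, support] at this
      linarith
    · rw [inner_sub_right, inner_add_right, inner_smul_right, inner_smul_right,
        inner_partialD_euclidean_yAff hr2 hx hξ hu (hK u hu),
        ← partialD_support hs hx hξ hy₁ hu, ← partialD_support hs hx hξ hy₂ hu]
      have h1 := partialD_congr hx.isOpen hu (g := fun v => μ • qAff x ξ v) hφμ k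
      rw [partialD_const_smul (partialD_qAff hr3 hx hξ hK hu).1, hφ' u hu, smul_eq_mul] at h1
      linarith
  have d₁ : ∀ u ∈ U, DifferentiableAt ℝ y₁ u := fun u hu =>
    differentiableAt_of_contDiffOn hx.isOpen hy₁.contDiffOn hs hu
  have d₂ : ∀ u ∈ U, DifferentiableAt ℝ y₂ u := fun u hu =>
    differentiableAt_of_contDiffOn hx.isOpen hy₂.contDiffOn hs hu
  have dα₁ : ∀ u ∈ U, DifferentiableAt ℝ (fun v => α • y₁ v) u := fun u hu =>
    (d₁ u hu).const_smul α
  refine ⟨μ, fun u hu => ⟨?_, ?_⟩⟩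
  · rw [beltrami_eq hn hr hs hx hy₁
      (fun v hv => det_relMetric_ne_zero hx hξ hy₁ hv (hK v hv)) hu,
      beltrami_eq hn hr hs hx hy₂
      (fun v hv => det_relMetric_ne_zero hx hξ hy₂ hv (hK v hv)) hu, hT u hu, hy u hu]
    module
  · have hB₁ := (shapeOp_eq_iff hx hy₁ hu _).1 rfl
    have hB : shapeOp x y₂ u = α • shapeOp x y₁ u + μ • shapeOp x (yAff x ξ) u := by
      rw [shapeOp_eq_iff hx hy₂ hu]
      intro i
      -- For `μ ≠ 0`, `y_AFF` inherits regularity and tangency of derivatives from `μ⁻¹ (y₂ - α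
      -- y₁)`. For `μ = 0` its shape operator has coefficient zero, so neither is needed.
      by_cases hμ0 : μ = 0
      · rw [partialD_congr hx.isOpen hu (g := fun v => α • y₁ v)
          (fun v hv => by rw [hy v hv, hμ0, zero_smul, add_zero]),
          partialD_const_smul (d₁ u hu), hB₁ i]
        simp [hμ0, Finset.smul_sum, smul_smul]
      · have hA : Set.EqOn (yAff x ξ) (fun v => μ⁻¹ • (y₂ v - α • y₁ v)) U := fun v hv => by
          simp only [hy v hv, add_sub_cancel_left, smul_smul, inv_mul_cancel₀ hμ0, one_smul]
        have hA' : ∀ v ∈ U, ∀ i, partialD i (yAff x ξ) v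
            = μ⁻¹ • (partialD i y₂ v - α • partialD i y₁ v) := fun v hv i => by
          rw [partialD_congr hx.isOpen hv hA, partialD_const_smul ((d₂ v hv).fun_sub (dα₁ v hv)),
            partialD_sub (d₂ v hv) (dα₁ v hv), partialD_const_smul (d₁ v hv)]
        have hyA : IsRelativeNormalization 1 U x (yAff x ξ) :=
          { contDiffOn := (((hy₂.contDiffOn.of_le hs).sub
              ((hy₁.contDiffOn.of_le hs).const_smul α)).const_smul μ⁻¹).congr hA
            transversal := fun v hv hmem => (qAff_pos (hK v hv)).ne' <| by
              rw [← inner_euclidean_yAff hξ hv]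
              exact inner_eq_zero_of_mem_tangentSpan (hξ.normal v hv) hmem
            tangential := fun v hv i => by
              rw [hA' v hv]
              exact Submodule.smul_mem _ _ (Submodule.sub_mem _ (hy₂.tangential v hv i)
                (Submodule.smul_mem _ _ (hy₁.tangential v hv i))) }
        have hBA := (shapeOp_eq_iff hx hyA hu _).1 rfl i
        rw [hA' u hu, inv_smul_eq_iff₀ hμ0, sub_eq_iff_eq_add, hB₁ i] at hBA
        rw [hBA]
        simp only [Matrix.add_apply, Matrix.smul_apply, smul_eq_mul, add_smul,
          Finset.sum_add_distrib, mul_smul, ← Finset.smul_sum]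
        module
    rw [relMeanCurvature, hB, relMeanCurvature, relMeanCurvature, Matrix.trace_add,
      Matrix.trace_smul, Matrix.trace_smul, smul_eq_mul, smul_eq_mul]
    ring
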